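/- Let $X$ and $Y$ be uniformly locally finite metric spaces, i.e. for every $r>0$ the closed balls of radius $r$ have uniformly bounded cardinality. Let $\mathrm{C}^*_u(X)\subset\mathcal{B}(\ell_2(X))$ denote the uniform Roe algebra of $X$: the norm closure of the $*$-algebra of all bounded operators $a$ on $\ell_2(X)$ of finite propagation, that is, for which there is $r$ such that $\langle a\delta_x,\delta_y\rangle=0$ whenever $d(x,y)>r$; define $\mathrm{C}^*_u(Y)$ likewise. Let $1_X\in \mathrm{C}^*_u(X)$ be the identity of $\ell_2(X)$, and let $\mathcal{K}(H)$ be the compact operators on a Hilbert space $H$; for a closed subspace $H'\subset H$, regard $\mathcal{K}(H')$ as a subset of $\mathcal{B}(H)$ by extending operators by $0$ on the orthogonal complement of $H'$. Let $\Phi:\mathrm{C}^*_u(X)\to\mathrm{C}^*_u(Y)$ be an embedding, i.e. an injective (not necessarily unital) $*$-homomorphism. Then the following are equivalent: 1. $\Phi$ is spatially implemented by an isometry: there is a linear isometry $u:\ell_2(X)\to\ell_2(Y)$ with $\Phi(a)=uau^*$ for all $a\in \mathrm{C}^*_u(X)$; 2. $\Phi$ is rank-preserving (the rank of $\Phi(a)$,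 in $\mathbb{N}\cup\{\infty\}$, equals the rank of $a$ for all $a\in\mathrm{C}^*_u(X)$) and strongly continuous (continuous for the strong operator topologies on $\mathrm{C}^*_u(X)$ and $\mathrm{C}^*_u(Y)$); 3. $\Phi(1_X)\,\mathcal{K}(\ell_2(Y))\,\Phi(1_X)\subset\Phi(\mathrm{C}^*_u(X))$; 4. there is a closed subspace $H'\subset\ell_2(Y)$ such that $\mathcal{K}(H')\subset\Phi(\mathrm{C}^*_u(X))$ and $\mathcal{K}(H')$ is an essential ideal of $A$, where $A$ is the hereditary $\mathrm{C}^*$-subalgebra of $\mathrm{C}^*_u(Y)$ generated by $\Phi(\mathrm{C}^*_u(X))$ (the smallest norm-closed $*$-subalgebra $B$ of $\mathrm{C}^*_u(Y)$ that contains $\Phi(\mathrm{C}^*_u(X))$ and satisfies: $0\le a\le b$, $a\in \mathrm{C}^*_u(Y)$, $b\in B$ imply $a\in B$). Essential means that $a\,\mathcal{K}(H')=0$ implies $a=0$ for all $a\in A$. -/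

import Mathlib

open scoped InnerProductSpace

/-- A metric space is uniformly locally finite if, for each `r > 0`, the cardinalities of the
closed balls of radius `r` are uniformly bounded. -/
def UniformlyLocallyFinite (X : Type*) [MetricSpace X] : Prop :=
  ∀ r : ℝ, 0 < r → ∃ N : ℕ, ∀ x : X, (Metric.closedBall x r).encard ≤ N

/-- The Hilbert space `ℓ₂(X)` of square-summable complex functions on `X`. -/
abbrev Ell2 (X : Type*) : Type _ := lp (fun _ : X => ℂ) 2

/-- The bounded operators on a Hilbert space. -/
abbrev BddOp (H : Type*) [NormedAddCommGroup H] [InnerProductSpace ℂ H] : Type _ := H →L[ℂ] H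

namespace UniformRoe

open Classical in
/-- The standard unit vector `δ_x` of `ℓ₂(X)`. -/
noncomputable def delta {X : Type*} (x : X) : Ell2 X := lp.single 2 x (1 : ℂ)

theorem inner_delta_left {X : Type*} (x : X) (f : Ell2 X) : ⟪delta x, f⟫_ℂ = f x := by
  classical
  have h := lp.inner_single_left (𝕜 := ℂ) (G := fun _ : X => ℂ) x (1 : ℂ) f
  rw [delta]
  convert h using 1
  simp

/-- The propagation of `a` is at most `r`: the matrix entry of `a` at `(x, y)` vanishes whenever
`d(x, y) > r`. -/
def PropagationLE {X : Type*} [MetricSpace X] (a : BddOp (Ell2 X)) (r : ℝ) : Prop :=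
  ∀ x y : X, r < dist x y → ⟪delta y, a (delta x)⟫_ℂ = 0

theorem PropagationLE.mono {X : Type*} [MetricSpace X] {a : BddOp (Ell2 X)} {r s : ℝ}
    (h : PropagationLE a r) (hrs : r ≤ s) : PropagationLE a s :=
  fun x y hxy => h x y (hrs.trans_lt hxy)

theorem PropagationLE.add {X : Type*} [MetricSpace X] {a b : BddOp (Ell2 X)} {r s : ℝ}
    (ha : PropagationLE a r) (hb : PropagationLE b s) : PropagationLE (a + b) (max r s) := by
  intro x y hxy
  rw [add_apply, inner_add_right,
    ha x y ((le_max_left _ _).trans_lt hxy), hb x y ((le_max_right _ _).trans_lt hxy), add_zero]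

theorem PropagationLE.star {X : Type*} [MetricSpace X] {a : BddOp (Ell2 X)} {r : ℝ}
    (ha : PropagationLE a r) : PropagationLE (star a) r := by
  intro x y hxy
  rw [ContinuousLinearMap.star_eq_adjoint, ContinuousLinearMap.adjoint_inner_right,
    ← inner_conj_symm, ha y x (by rwa [dist_comm]), map_zero]

theorem PropagationLE.mul {X : Type*} [MetricSpace X] {a b : BddOp (Ell2 X)} {r s : ℝ}
    (ha : PropagationLE a r) (hb : PropagationLE b s) : PropagationLE (a * b) (r + s) := by
  intro x y hxy
  rw [mul_apply_eq_comp, ← ContinuousLinearMap.adjoint_inner_left, lp.inner_eq_tsum]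
  refine (tsum_congr fun z => ?_).trans tsum_zero
  by_cases hz : s < dist x z
  · have h := hb x z hz
    rw [inner_delta_left] at h
    rw [h, inner_zero_right]
  · have h := ha.star y z (by
      have := dist_triangle x z y
      rw [dist_comm y z]
      linarith)
    rw [inner_delta_left, ContinuousLinearMap.star_eq_adjoint] at h
    rw [h, inner_zero_left]

theorem propagationLE_algebraMap {X : Type*} [MetricSpace X] (c : ℂ) :
    PropagationLE (algebraMap ℂ (BddOp (Ell2 X)) c) 0 := by
  classical
  intro x y hxy
  have hne : y ≠ x := fun h => by simp [h] at hxy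
  rw [Algebra.algebraMap_eq_smul_one, smul_apply,
    one_apply_eq_self, inner_smul_right, inner_delta_left]
  simp [delta, lp.single_apply, hne]

/-- The algebraic uniform Roe algebra: the `*`-algebra of all bounded operators on `ℓ₂(X)` of
finite propagation. -/
def algebraicUniformRoeAlgebra (X : Type*) [MetricSpace X] : StarSubalgebra ℂ (BddOp (Ell2 X)) where
  carrier := {a | ∃ r : ℝ, PropagationLE a r}
  mul_mem' := fun ⟨_, ha⟩ ⟨_, hb⟩ => ⟨_, ha.mul hb⟩
  add_mem' := fun ⟨_, ha⟩ ⟨_, hb⟩ => ⟨_, ha.add hb⟩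
  algebraMap_mem' := fun c => ⟨0, propagationLE_algebraMap c⟩
  star_mem' := fun ⟨_, ha⟩ => ⟨_, ha.star⟩

end UniformRoe

/-- The uniform Roe algebra of `X`: the norm closure of the algebraic uniform Roe algebra. -/
noncomputable def uniformRoeAlgebra (X : Type*) [MetricSpace X] :
    StarSubalgebra ℂ (BddOp (Ell2 X)) :=
  (UniformRoe.algebraicUniformRoeAlgebra X).topologicalClosure

namespace UniformRoe

/-- The strong operator topology on the uniform Roe algebra, i.e. the topology of pointwise
convergence on vectors of `ℓ₂(X)`. -/
noncomputable abbrev strongOperatorTopology (X : Type*) [MetricSpace X] :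
    TopologicalSpace (uniformRoeAlgebra X) :=
  TopologicalSpace.induced
    (fun (a : uniformRoeAlgebra X) (ξ : Ell2 X) => (a : BddOp (Ell2 X)) ξ) inferInstance

/-- Continuity with respect to the strong operator topologies of the domain and the codomain. -/
def StronglyContinuous {X Y : Type*} [MetricSpace X] [MetricSpace Y]
    (Φ : uniformRoeAlgebra X → uniformRoeAlgebra Y) : Prop :=
  @Continuous _ _ (strongOperatorTopology X) (strongOperatorTopology Y) Φ

/-- The rank of an operator, the dimension of its range, as an element of `ℕ ∪ {∞}`. -/
noncomputable def opRank {H : Type*} [NormedAddCommGroup H] [InnerProductSpace ℂ H]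
    (a : BddOp H) : ℕ∞ :=
  Cardinal.toENat (LinearMap.rank (a : H →ₗ[ℂ] H))

/-- `Φ` is rank-preserving: `a` and `Φ a` have the same rank, for all `a`. -/
def RankPreserving {X Y : Type*} [MetricSpace X] [MetricSpace Y]
    (Φ : uniformRoeAlgebra X → uniformRoeAlgebra Y) : Prop :=
  ∀ a : uniformRoeAlgebra X, opRank (Φ a : BddOp (Ell2 Y)) = opRank (a : BddOp (Ell2 X))

/-- `Φ = Ad(u)`, that is, `Φ(a) = u a u*` for all `a`. -/
def ImplementedBy {X Y : Type*} [MetricSpace X] [MetricSpace Y]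
    (Φ : uniformRoeAlgebra X → uniformRoeAlgebra Y) (u : Ell2 X →ₗᵢ[ℂ] Ell2 Y) : Prop :=
  ∀ a : uniformRoeAlgebra X, (Φ a : BddOp (Ell2 Y)) =
    u.toContinuousLinearMap ∘L (a : BddOp (Ell2 X)) ∘L
      ContinuousLinearMap.adjoint u.toContinuousLinearMap

section Hilbert

variable {H : Type*} [NormedAddCommGroup H] [InnerProductSpace ℂ H]

/-- For a closed subspace `K` of `H`, the compact operators on `K`, seen as operators on `H` that
map into `K` and vanish on the orthogonal complement of `K`. -/
def compactOperatorsOn (K : Submodule ℂ H) : Submodule ℂ (BddOp H) where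
  carrier := {T | IsCompactOperator T ∧ (∀ ξ, T ξ ∈ K) ∧ ∀ ξ ∈ Kᗮ, T ξ = 0}
  zero_mem' := ⟨isCompactOperator_zero, fun _ => K.zero_mem, fun _ _ => rfl⟩
  add_mem' := fun {S T} hS hT => ⟨hS.1.add hT.1, fun ξ => K.add_mem (hS.2.1 ξ) (hT.2.1 ξ),
    fun ξ hξ => by rw [add_apply, hS.2.2 ξ hξ, hT.2.2 ξ hξ, add_zero]⟩
  smul_mem' := fun c T hT => ⟨hT.1.smul c, fun ξ => K.smul_mem c (hT.2.1 ξ),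
    fun ξ hξ => by rw [smul_apply, hT.2.2 ξ hξ, smul_zero]⟩

variable [CompleteSpace H]

/-- `B` is a hereditary C*-subalgebra of the C*-algebra `D` of operators on `H`: a norm-closed
`*`-subalgebra of `D` with `a ∈ B` whenever `a ∈ D`, `b ∈ B` and `0 ≤ a ≤ b`. -/
structure IsHereditarySubalgebra (D : StarSubalgebra ℂ (BddOp H))
    (B : NonUnitalStarSubalgebra ℂ (BddOp H)) : Prop where
  subset : (B : Set (BddOp H)) ⊆ D
  isClosed : IsClosed (B : Set (BddOp H))
  mem_of_le : ∀ a b : BddOp H, a ∈ D → b ∈ B → 0 ≤ a → a ≤ b → a ∈ B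

/-- The hereditary C*-subalgebra of `D` generated by `S`: the smallest one that contains `S`. -/
noncomputable def hereditarySubalgebra (D : StarSubalgebra ℂ (BddOp H)) (S : Set (BddOp H)) :
    NonUnitalStarSubalgebra ℂ (BddOp H) :=
  sInf {B | IsHereditarySubalgebra D B ∧ S ⊆ B}

/-- `J` is an essential ideal of the C*-algebra `B`: a closed two-sided ideal of `B` such that
`a J = 0` implies `a = 0`, for all `a ∈ B`. -/
structure IsEssentialIdeal (J : Submodule ℂ (BddOp H))
    (B : NonUnitalStarSubalgebra ℂ (BddOp H)) : Prop where
  subset : (J : Set (BddOp H)) ⊆ B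
  isClosed : IsClosed (J : Set (BddOp H))
  mul_mem_left : ∀ b ∈ B, ∀ j ∈ J, b * j ∈ J
  mul_mem_right : ∀ b ∈ B, ∀ j ∈ J, j * b ∈ J
  essential : ∀ a ∈ B, (∀ j ∈ J, a * j = 0) → a = 0

end Hilbert

/-- The range of `Φ`, as a set of operators on `ℓ₂(Y)`. -/
def opRange {X Y : Type*} [MetricSpace X] [MetricSpace Y]
    (Φ : uniformRoeAlgebra X → uniformRoeAlgebra Y) : Set (BddOp (Ell2 Y)) :=
  Set.range fun a : uniformRoeAlgebra X => (Φ a : BddOp (Ell2 Y))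

end UniformRoe

/-! The matrix units e_xy, which send δ_y to δ_x, lie in the uniform Roe algebra and control Φ. If
some Φ(e_{x₀x₀}) is the projection onto a unit vector η, then the vectors w_x = Φ(e_{xx₀})η are
orthonormal and Φ(e_xy) is the rank one operator sending w_y to w_x. The isometry u with uδ_x = w_x
satisfies u*Φ(a)u = a, by comparing matrix entries. Hence Φ = Ad(u) as soon as Φ(1) = uu*, which
holds if every vector killed by all Φ(e_xx) is killed by Φ(1). This is
`exists_isometry_of_map_matrixUnit`.

Conditions 2 and 3 each supply both ingredients. Under 2, rank preservation makes Φ(e_xx) of rank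
one, and strong continuity passes from the finite sums of the e_xx to their limit 1. Under 3, a rank
one projection below Φ(e_xx) is some Φ(b), and e_xx b e_xx is a multiple of e_xx; moreover, if all
Φ(e_xx) kill ξ, the rank one operator of Φ(1)ξ is some Φ(b) with b e_xx = 0 for all x, so b = 0
(`exists_isometry_of_compact_subset_range`). Conversely, Ad(u) has property 2 by inspection, and
property 3 because u*ku is compact and the uniform Roe algebra contains the compact operators.

For 3 ⇔ 4, the subspace H' has to be the range of Φ(1): it lies inside since K(H') is in the range
of Φ, and essentiality leaves no room for more (`map_one_apply_mem_of_isEssentialIdeal`). -/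

namespace UniformRoe

open InnerProductSpace (rankOne)

/-! ### Compact operators, corners and hereditary subalgebras on a Hilbert space. -/

section Hilbert

variable {H : Type*} [NormedAddCommGroup H] [InnerProductSpace ℂ H]

theorem isCompactOperator_rankOne (x y : H) : IsCompactOperator (rankOne ℂ x y) := by
  rw [InnerProductSpace.rankOne_def', ContinuousLinearMap.coe_comp]
  exact (isCompactOperator_of_locallyCompactSpace_rng
    (ContinuousLinearMap.toSpanSingleton ℂ x)).comp_clm (innerSL ℂ y)

variable [CompleteSpace H]

/-- A norm-closed subspace of operators that contains all rank one operators contains all compact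
operators. -/
theorem mem_of_isCompactOperator {S : Submodule ℂ (BddOp H)} (hS : IsClosed (S : Set (BddOp H)))
    (h1 : ∀ x y : H, rankOne ℂ x y ∈ S) {k : BddOp H} (hk : IsCompactOperator k) : k ∈ S := by
  change k ∈ (S : Set (BddOp H))
  rw [← hS.closure_eq, Metric.mem_closure_iff]
  intro ε hε
  have htb : TotallyBounded (k '' Metric.closedBall 0 1) := by
    have := IsCompactOperator.isCompact_closure_image_closedBall (f := (k : H →ₗ[ℂ] H)) hk 1
    exact this.totallyBounded.subset subset_closure
  obtain ⟨t, htf, ht⟩ := Metric.totallyBounded_iff.1 htb (ε / 2) (half_pos hε)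
  -- `V` is spanned by a finite ε/2-net of the image of the unit ball, so projecting onto `V` moves
  -- each `k x` by at most ε/2, while the projection is a finite sum of rank one operators.
  set V : Submodule ℂ H := Submodule.span ℂ t
  have : FiniteDimensional ℂ V := FiniteDimensional.span_of_finite ℂ htf
  refine ⟨V.starProjection * k, ?_, ?_⟩
  · rw [(stdOrthonormalBasis ℂ V).starProjection_eq_sum_rankOne, Finset.sum_mul]
    refine S.sum_mem fun i _ => ?_
    rw [ContinuousLinearMap.mul_def, InnerProductSpace.rankOne_comp]
    exact h1 _ _
  · rw [dist_eq_norm]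
    refine lt_of_le_of_lt ?_ (half_lt_self hε)
    refine ContinuousLinearMap.opNorm_le_of_unit_norm (half_pos hε).le fun x hx => ?_
    obtain ⟨v, hv, hxv⟩ := Set.mem_iUnion₂.1
      (ht ⟨x, by simp [hx], rfl⟩)
    have hmin := V.starProjection_minimal (k x)
    calc ‖(k - V.starProjection * k) x‖ = ‖k x - V.starProjection (k x)‖ := rfl
      _ ≤ ‖k x - v‖ := by
        rw [hmin]
        exact ciInf_le ⟨0, by rintro _ ⟨w, rfl⟩; positivity⟩
          (⟨v, Submodule.subset_span hv⟩ : V)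
      _ ≤ ε / 2 := by rw [← dist_eq_norm]; exact (Metric.mem_ball.1 hxv).le

/-- The corner `p D p` of an algebra `D` of operators, for a projection `p`. -/
def corner (D : StarSubalgebra ℂ (BddOp H)) (p : BddOp H) (hp : IsStarProjection p) :
    NonUnitalStarSubalgebra ℂ (BddOp H) where
  carrier := {a | a ∈ D ∧ p * a = a ∧ a * p = a}
  zero_mem' := ⟨D.zero_mem, mul_zero _, zero_mul _⟩
  add_mem' := fun {a b} ha hb => ⟨D.add_mem ha.1 hb.1, by rw [mul_add, ha.2.1, hb.2.1],
    by rw [add_mul, ha.2.2, hb.2.2]⟩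
  mul_mem' := fun {a b} ha hb => ⟨D.mul_mem ha.1 hb.1, by rw [← mul_assoc, ha.2.1],
    by rw [mul_assoc, hb.2.2]⟩
  smul_mem' := fun c a ha => ⟨D.smul_mem ha.1 c, by rw [mul_smul_comm, ha.2.1],
    by rw [smul_mul_assoc, ha.2.2]⟩
  star_mem' := fun {a} ha => ⟨star_mem ha.1,
    by simpa [hp.isSelfAdjoint.star_eq] using congrArg star ha.2.2,
    by simpa [hp.isSelfAdjoint.star_eq] using congrArg star ha.2.1⟩

/-- A positive operator dominated by one that is supported on the range of the projection `p` is
itself supported there. -/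
theorem mul_eq_self_of_le {p a b : BddOp H} (hp : IsStarProjection p) (ha : 0 ≤ a) (hab : a ≤ b)
    (hb : b * p = b) : a * p = a := by
  obtain ⟨s, rfl⟩ := CStarAlgebra.nonneg_iff_eq_star_mul_self.1 ha
  have hq : star (1 - p) = 1 - p := by rw [star_sub, star_one, hp.isSelfAdjoint.star_eq]
  -- Compressing a = s*s ≤ b by 1 - p gives (s(1 - p))*(s(1 - p)) ≤ 0, so s(1 - p) = 0.
  have h := star_left_conjugate_le_conjugate hab (1 - p)
  have hb0 : b * (1 - p) = 0 := by rw [mul_sub, mul_one, hb, sub_self]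
  rw [mul_assoc _ b, hb0, mul_zero] at h
  have h0 : 0 ≤ star (s * (1 - p)) * (s * (1 - p)) := star_mul_self_nonneg _
  have h1 : star (s * (1 - p)) * (s * (1 - p)) = 0 := by
    refine le_antisymm (le_of_eq_of_le ?_ h) h0
    simp only [star_mul, mul_assoc]
  have h2 := CStarRing.star_mul_self_eq_zero_iff _ |>.1 h1
  have h3 : star s * s * (1 - p) = 0 := by rw [mul_assoc, h2, mul_zero]
  rw [mul_sub, mul_one, sub_eq_zero] at h3
  exact h3.symm

theorem isHereditarySubalgebra_corner {D : StarSubalgebra ℂ (BddOp H)}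
    (hD : IsClosed (D : Set (BddOp H))) {p : BddOp H} (hp : IsStarProjection p) :
    IsHereditarySubalgebra D (corner D p hp) where
  subset := fun _ ha => ha.1
  isClosed := hD.inter ((isClosed_eq (continuous_const.mul continuous_id) continuous_id).inter
    (isClosed_eq (continuous_id.mul continuous_const) continuous_id))
  mem_of_le := fun a b ha hb h0 hab => by
    have h := mul_eq_self_of_le hp h0 hab hb.2.2
    refine ⟨ha, ?_, h⟩
    simpa [hp.isSelfAdjoint.star_eq, (IsSelfAdjoint.of_nonneg h0).star_eq] using congrArg star h

theorem subset_hereditarySubalgebra (D : StarSubalgebra ℂ (BddOp H)) (S : Set (BddOp H)) :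
    S ⊆ hereditarySubalgebra D S := by
  intro a ha
  refine NonUnitalStarAlgebra.mem_sInf.2 fun B hB => hB.2 ha

theorem hereditarySubalgebra_le {D : StarSubalgebra ℂ (BddOp H)} {S : Set (BddOp H)}
    {B : NonUnitalStarSubalgebra ℂ (BddOp H)} (hB : IsHereditarySubalgebra D B) (hS : S ⊆ B) :
    hereditarySubalgebra D S ≤ B :=
  sInf_le ⟨hB, hS⟩

theorem mem_hereditarySubalgebra_of_le {D : StarSubalgebra ℂ (BddOp H)} {S : Set (BddOp H)}
    {a b : BddOp H} (ha : a ∈ D) (hb : b ∈ S) (h0 : 0 ≤ a) (hab : a ≤ b) :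
    a ∈ hereditarySubalgebra D S :=
  NonUnitalStarAlgebra.mem_sInf.2 fun _ hB => hB.1.mem_of_le a b ha (hB.2 hb) h0 hab

theorem isClosed_compactOperatorsOn {K : Submodule ℂ H} (hK : IsClosed (K : Set H)) :
    IsClosed (compactOperatorsOn K : Set (BddOp H)) := by
  have h1 : IsClosed {T : BddOp H | IsCompactOperator T} := isClosed_setOfPred_isCompactOperator
  have h2 : IsClosed {T : BddOp H | ∀ ξ, T ξ ∈ K} := by
    simp only [Set.ofPred_forall]
    exact isClosed_iInter fun ξ => hK.preimage (ContinuousLinearMap.apply ℂ H ξ).continuous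
  have h3 : IsClosed {T : BddOp H | ∀ ξ ∈ Kᗮ, T ξ = 0} := by
    simp only [Set.ofPred_forall]
    exact isClosed_iInter fun ξ => isClosed_iInter fun _ =>
      isClosed_eq (ContinuousLinearMap.apply ℂ H ξ).continuous continuous_const
  exact h1.inter (h2.inter h3)

/-- Membership in the compact operators on the range of a projection `p`. -/
theorem mem_compactOperatorsOn_range_iff {p : BddOp H} (hp : IsStarProjection p) {T : BddOp H} :
    T ∈ compactOperatorsOn (LinearMap.range (p : H →ₗ[ℂ] H)) ↔
      IsCompactOperator T ∧ p * T = T ∧ T * p = T := by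
  have hpp : ∀ ξ, p (p ξ) = p ξ := fun ξ => DFunLike.congr_fun hp.isIdempotentElem ξ
  have hsa : ∀ ξ η, ⟪p ξ, η⟫_ℂ = ⟪ξ, p η⟫_ℂ := fun ξ η => by
    have h := hp.isSelfAdjoint.star_eq
    rw [ContinuousLinearMap.star_eq_adjoint] at h
    conv_lhs => rw [← h]
    exact ContinuousLinearMap.adjoint_inner_left _ _ _
  refine and_congr_right fun _ => and_congr ⟨fun h => ?_, fun h ξ => ?_⟩
    ⟨fun h => ?_, fun h ξ hξ => ?_⟩
  · ext1 ξ
    obtain ⟨ζ, hζ⟩ := h ξ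
    change p (T ξ) = T ξ
    rw [← hζ]
    exact hpp ζ
  · exact ⟨T ξ, DFunLike.congr_fun h ξ⟩
  · ext1 ξ
    have : T (ξ - p ξ) = 0 := h _ <| by
      rw [Submodule.mem_orthogonal]
      rintro _ ⟨ζ, rfl⟩
      change ⟪p ζ, _⟫_ℂ = 0
      rw [hsa, map_sub, hpp, sub_self, inner_zero_right]
    rw [map_sub, sub_eq_zero] at this
    exact this.symm
  · have : p ξ = 0 := by
      rw [← inner_self_eq_zero (𝕜 := ℂ), hsa, hpp, ← hsa]
      exact (Submodule.mem_orthogonal _ _).1 hξ _ ⟨ξ, rfl⟩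
    rw [← h]
    change T (p ξ) = 0
    rw [this, map_zero]

/-- Since p fixes ξ, the difference of the two projections is again a projection, hence positive. -/
theorem rankOne_self_le {p : BddOp H} (hp : IsStarProjection p) {ξ : H} (hξ : ‖ξ‖ = 1)
    (h : p ξ = ξ) : rankOne ℂ ξ ξ ≤ p := by
  have hr := InnerProductSpace.isStarProjection_rankOne_self (𝕜 := ℂ) hξ
  refine sub_nonneg.1 (hr.sub_of_mul_eq_right hp ?_).nonneg
  rw [ContinuousLinearMap.mul_def, InnerProductSpace.comp_rankOne, h]

end Hilbert

/-! ### The standard basis of ℓ₂ and isometries defined on it. -/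

section Ell2

variable {X : Type*}

theorem ext_inner_delta {f g : Ell2 X} (h : ∀ x, ⟪delta x, f⟫_ℂ = ⟪delta x, g⟫_ℂ) : f = g := by
  ext x
  rw [← inner_delta_left, ← inner_delta_left, h]

theorem norm_delta (x : X) : ‖(delta x : Ell2 X)‖ = 1 := by
  classical
  rw [delta, lp.norm_single (by norm_num), norm_one]

theorem inner_delta_delta_of_ne {x y : X} (h : x ≠ y) : ⟪delta x, delta y⟫_ℂ = 0 := by
  classical
  rw [inner_delta_left, delta, lp.single_apply, Pi.single_eq_of_ne h]

theorem ext_apply_delta {H : Type*} [NormedAddCommGroup H] [InnerProductSpace ℂ H]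
    [CompleteSpace H] {S T : Ell2 X →L[ℂ] H} (h : ∀ x, S (delta x) = T (delta x)) : S = T := by
  rw [← ContinuousLinearMap.adjoint_adjoint S, ← ContinuousLinearMap.adjoint_adjoint T]
  congr 1
  ext1 ξ
  exact ext_inner_delta fun x => by
    rw [ContinuousLinearMap.adjoint_inner_right, ContinuousLinearMap.adjoint_inner_right, h]

theorem ext_inner_apply_delta {S T : BddOp (Ell2 X)}
    (h : ∀ x y, ⟪delta y, S (delta x)⟫_ℂ = ⟪delta y, T (delta x)⟫_ℂ) : S = T :=
  ext_apply_delta fun x => ext_inner_delta fun y => h x y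

theorem mem_of_forall_delta_mem {S : Submodule ℂ (Ell2 X)} (hS : IsClosed (S : Set (Ell2 X)))
    (h : ∀ x, delta x ∈ S) (ξ : Ell2 X) : ξ ∈ S := by
  classical
  have hs := lp.hasSum_single (p := 2) (by simp) ξ
  refine hS.mem_of_tendsto hs (Filter.Eventually.of_forall fun s => S.sum_mem fun x _ => ?_)
  have : lp.single 2 x (ξ x) = ξ x • (delta x : Ell2 X) := by
    rw [delta, ← lp.single_smul, smul_eq_mul, mul_one]
  rw [this]
  exact S.smul_mem _ (h x)

/-- An orthonormal family extends to an isometry of `ℓ₂`. -/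
theorem exists_isometry_apply_delta {H : Type*} [NormedAddCommGroup H]
    [InnerProductSpace ℂ H] [CompleteSpace H] {w : X → H} (hw : Orthonormal ℂ w) :
    ∃ u : Ell2 X →ₗᵢ[ℂ] H, ∀ x, u (delta x) = w x := by
  classical
  refine ⟨hw.orthogonalFamily.linearIsometry, fun x => ?_⟩
  have h := hw.orthogonalFamily.linearIsometry_apply_single (i := x) (1 : ℂ)
  rw [delta]
  convert h using 1
  simp

theorem adjoint_apply_apply {H : Type*} [NormedAddCommGroup H] [InnerProductSpace ℂ H]
    [CompleteSpace H] (u : Ell2 X →ₗᵢ[ℂ] H) (ξ : Ell2 X) :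
    ContinuousLinearMap.adjoint u.toContinuousLinearMap (u.toContinuousLinearMap ξ) = ξ :=
  DFunLike.congr_fun ((ContinuousLinearMap.norm_map_iff_adjoint_comp_self
    u.toContinuousLinearMap).1 u.norm_map) ξ

end Ell2

/-! ### Compact operators and matrix units in the uniform Roe algebra. -/

section Roe

variable {X : Type*} [MetricSpace X]

theorem isClosed_uniformRoeAlgebra : IsClosed (uniformRoeAlgebra X : Set (BddOp (Ell2 X))) :=
  StarSubalgebra.isClosed_topologicalClosure _

theorem rankOne_delta_mem (x y : X) :
    rankOne ℂ (delta x) (delta y) ∈ uniformRoeAlgebra X := by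
  refine StarSubalgebra.le_topologicalClosure _ ⟨dist y x, fun z w hzw => ?_⟩
  rw [InnerProductSpace.rankOne_apply, inner_smul_right]
  by_cases hz : y = z
  · by_cases hw : w = x
    · subst hz hw
      exact absurd hzw (lt_irrefl _)
    · rw [inner_delta_delta_of_ne hw, mul_zero]
  · rw [inner_delta_delta_of_ne hz, zero_mul]

/-- The compact operators belong to the uniform Roe algebra. -/
theorem mem_uniformRoeAlgebra_of_isCompactOperator {k : BddOp (Ell2 X)}
    (hk : IsCompactOperator k) : k ∈ uniformRoeAlgebra X := by
  have hc := isClosed_uniformRoeAlgebra (X := X)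
  let A : Submodule ℂ (BddOp (Ell2 X)) := Subalgebra.toSubmodule (uniformRoeAlgebra X).toSubalgebra
  have hA : IsClosed (A : Set (BddOp (Ell2 X))) := hc
  let L (g : Ell2 X) : Ell2 X →L[ℂ] BddOp (Ell2 X) :=
    (rankOne ℂ : Ell2 X →L[ℂ] Ell2 X →L⋆[ℂ] BddOp (Ell2 X)).flip g
  -- `rankOne` is only conjugate-linear in its second argument, so the density argument is run in
  -- the first one, and the adjoint exchanges the two.
  have h1 : ∀ (x : X) (g : Ell2 X), rankOne ℂ (delta x) g ∈ A := by
    intro x g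
    have hadj : ∀ g : Ell2 X, rankOne ℂ g (delta x) ∈ A :=
      mem_of_forall_delta_mem (S := A.comap (L (delta x)).toLinearMap)
        (hA.preimage (L (delta x)).continuous) fun y => rankOne_delta_mem y x
    have h : star (rankOne ℂ g (delta x)) ∈ uniformRoeAlgebra X :=
      star_mem (show rankOne ℂ g (delta x) ∈ uniformRoeAlgebra X from hadj g)
    rwa [ContinuousLinearMap.star_eq_adjoint, InnerProductSpace.adjoint_rankOne] at h
  have h2 : ∀ f g : Ell2 X, rankOne ℂ f g ∈ A := fun f g =>
    mem_of_forall_delta_mem (S := A.comap (L g).toLinearMap)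
        (hA.preimage (L g).continuous) (fun y => h1 y g) f
  exact mem_of_isCompactOperator hA h2 hk

/-- The matrix unit sending `δ_y` to `δ_x`. -/
noncomputable def matrixUnit (x y : X) : uniformRoeAlgebra X :=
  ⟨rankOne ℂ (delta x) (delta y), rankOne_delta_mem x y⟩

theorem coe_matrixUnit (x y : X) :
    (matrixUnit x y : BddOp (Ell2 X)) = rankOne ℂ (delta x) (delta y) := rfl

/-- Matrix units isolate a single entry of a. In particular each e_xx is a minimal projection; the
multiplication table is the case a = 1. -/
theorem matrixUnit_mul_mul (x y z w : X) (a : uniformRoeAlgebra X) :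
    matrixUnit x y * a * matrixUnit z w =
      ⟪delta y, (a : BddOp (Ell2 X)) (delta z)⟫_ℂ • matrixUnit x w := by
  ext1
  simp only [MulMemClass.coe_mul, coe_matrixUnit, SetLike.val_smul, mul_assoc]
  rw [ContinuousLinearMap.mul_def, ContinuousLinearMap.mul_def, InnerProductSpace.comp_rankOne,
    InnerProductSpace.rankOne_comp_rankOne]

theorem matrixUnit_mul_matrixUnit (x y z : X) :
    matrixUnit x y * matrixUnit y z = matrixUnit x z := by
  have h := matrixUnit_mul_mul x y y z 1
  simpa [norm_delta] using h

theorem matrixUnit_mul_matrixUnit_of_ne (x : X) {y z : X} (w : X) (h : y ≠ z) :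
    matrixUnit x y * matrixUnit z w = 0 := by
  simpa [inner_delta_delta_of_ne h] using matrixUnit_mul_mul x y z w 1

theorem star_matrixUnit (x y : X) : star (matrixUnit x y) = matrixUnit y x := by
  ext1
  exact InnerProductSpace.adjoint_rankOne _ _

theorem isStarProjection_matrixUnit (x : X) : IsStarProjection (matrixUnit x x) :=
  ⟨matrixUnit_mul_matrixUnit x x x, star_matrixUnit x x⟩

end Roe

/-! ### Representations determined by the images of the matrix units. -/

section Representation

variable {X : Type*} [MetricSpace X] {H : Type*} [NormedAddCommGroup H] [InnerProductSpace ℂ H]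
  [CompleteSpace H] (φ : uniformRoeAlgebra X →⋆ₙₐ[ℂ] BddOp H)

theorem map_one_mul (a : uniformRoeAlgebra X) : φ 1 * φ a = φ a := by
  rw [← map_mul, one_mul]

theorem map_mul_one (a : uniformRoeAlgebra X) : φ a * φ 1 = φ a := by
  rw [← map_mul, mul_one]

/-- If the matrix unit at `x₀` is represented by the projection onto the unit vector `η`, these
vectors form an orthonormal system that is permuted by the matrix units. -/
noncomputable def matrixUnitVector (x₀ : X) (η : H) (x : X) : H := φ (matrixUnit x x₀) η

variable {φ} {x₀ : X} {η : H}

/-- Factor e_xy = e_{xx₀} e_{x₀x₀} e_{x₀y} and absorb the images of the outer factors into the two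
vectors. -/
theorem map_matrixUnit (h : φ (matrixUnit x₀ x₀) = rankOne ℂ η η) (x y : X) :
    φ (matrixUnit x y) =
      rankOne ℂ (matrixUnitVector φ x₀ η x) (matrixUnitVector φ x₀ η y) := by
  have hs : φ (matrixUnit x₀ y) = ContinuousLinearMap.adjoint (φ (matrixUnit y x₀)) := by
    rw [← ContinuousLinearMap.star_eq_adjoint, ← map_star, star_matrixUnit]
  rw [← matrixUnit_mul_matrixUnit x x₀ y, ← matrixUnit_mul_matrixUnit x₀ x₀ y, map_mul, map_mul, h,
    ContinuousLinearMap.mul_def, ContinuousLinearMap.mul_def, hs, InnerProductSpace.rankOne_comp,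
    ContinuousLinearMap.adjoint_adjoint, InnerProductSpace.comp_rankOne]
  rfl

theorem orthonormal_matrixUnitVector (hη : ‖η‖ = 1)
    (h : φ (matrixUnit x₀ x₀) = rankOne ℂ η η) : Orthonormal ℂ (matrixUnitVector φ x₀ η) := by
  have hs : ∀ x y, ⟪matrixUnitVector φ x₀ η x, matrixUnitVector φ x₀ η y⟫_ℂ =
      ⟪η, φ (matrixUnit x₀ x * matrixUnit y x₀) η⟫_ℂ := fun x y => by
    rw [map_mul, ← star_matrixUnit x x₀, map_star, ContinuousLinearMap.star_eq_adjoint]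
    exact (ContinuousLinearMap.adjoint_inner_right _ _ _).symm
  classical
  rw [orthonormal_iff_ite]
  intro x y
  rw [hs]
  split_ifs with hxy
  · subst hxy
    rw [matrixUnit_mul_matrixUnit, h, InnerProductSpace.rankOne_apply]
    simp [hη]
  · rw [matrixUnit_mul_matrixUnit_of_ne _ _ hxy, map_zero, zero_apply, inner_zero_right]

theorem map_matrixUnit_apply_self {w : X → H} (hw : Orthonormal ℂ w)
    (hm : ∀ x y, φ (matrixUnit x y) = rankOne ℂ (w x) (w y)) (x y : X) :
    φ (matrixUnit x y) (w y) = w x := by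
  simp [hm, hw.1 y]

/-- The projections φ(e_xx) and φ(e_yy) fix w_x and w_y and can be inserted around φ(a); then e_yy a
e_xx is the matrix entry times e_yx. -/
theorem inner_map_apply {w : X → H} (hw : Orthonormal ℂ w)
    (hm : ∀ x y, φ (matrixUnit x y) = rankOne ℂ (w x) (w y)) (a : uniformRoeAlgebra X) (x y : X) :
    ⟪w y, φ a (w x)⟫_ℂ = ⟪delta y, (a : BddOp (Ell2 X)) (delta x)⟫_ℂ := by
  have hsa : ContinuousLinearMap.adjoint (φ (matrixUnit y y)) = φ (matrixUnit y y) := by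
    rw [hm, InnerProductSpace.adjoint_rankOne]
  have h : φ (matrixUnit y y) (φ a (φ (matrixUnit x x) (w x))) =
      ⟪delta y, (a : BddOp (Ell2 X)) (delta x)⟫_ℂ • w y := by
    rw [← mul_apply_eq_comp, ← map_mul, ← mul_apply_eq_comp, ← map_mul,
      matrixUnit_mul_mul, map_smul, smul_apply, map_matrixUnit_apply_self hw hm]
  have hyy := map_matrixUnit_apply_self hw hm y y
  calc ⟪w y, φ a (w x)⟫_ℂ = ⟪φ (matrixUnit y y) (w y), φ a (φ (matrixUnit x x) (w x))⟫_ℂ := by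
        rw [hyy, map_matrixUnit_apply_self hw hm]
    _ = ⟪w y, φ (matrixUnit y y) (φ a (φ (matrixUnit x x) (w x)))⟫_ℂ := by
        rw [← ContinuousLinearMap.adjoint_inner_right, hsa]
    _ = _ := by rw [h, inner_smul_right, inner_self_eq_norm_sq_to_K, hw.1 y]; simp

/-- The vector φ(1)ζ - UU*ζ is killed by every φ(e_xx), hence by φ(1) through `hsupp`; but φ(1) also
fixes it, because φ(1)U = U. -/
theorem map_one_eq {w : X → H} (hw : Orthonormal ℂ w)
    (hm : ∀ x y, φ (matrixUnit x y) = rankOne ℂ (w x) (w y))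
    (hsupp : ∀ ξ, (∀ x, φ (matrixUnit x x) ξ = 0) → φ 1 ξ = 0)
    (u : Ell2 X →ₗᵢ[ℂ] H) (hu : ∀ x, u.toContinuousLinearMap (delta x) = w x) :
    φ 1 = u.toContinuousLinearMap ∘L ContinuousLinearMap.adjoint u.toContinuousLinearMap := by
  set U := u.toContinuousLinearMap
  have h1U : φ 1 ∘L U = U := ext_apply_delta fun x => by
    have h1 := DFunLike.congr_fun (map_one_mul (φ := φ) (matrixUnit x x)) (w x)
    rw [mul_apply_eq_comp, map_matrixUnit_apply_self hw hm] at h1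
    rw [ContinuousLinearMap.comp_apply, hu, h1]
  ext1 ζ
  have h0 := hsupp (φ 1 ζ - U (ContinuousLinearMap.adjoint U ζ)) fun x => by
    rw [map_sub, ← mul_apply_eq_comp, map_mul_one, hm, InnerProductSpace.rankOne_apply,
      InnerProductSpace.rankOne_apply, ← hu, ← ContinuousLinearMap.adjoint_inner_right U,
      ← ContinuousLinearMap.adjoint_inner_right U, adjoint_apply_apply, sub_self]
  rw [map_sub, ← mul_apply_eq_comp, map_one_mul, ← ContinuousLinearMap.comp_apply, h1U,
    sub_eq_zero] at h0
  exact h0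

/-- A representation of the uniform Roe algebra in which a diagonal matrix unit is a rank one
projection and whose support is exhausted by the diagonal matrix units is implemented by an
isometry. -/
theorem exists_isometry_of_map_matrixUnit (hη : ‖η‖ = 1)
    (h : φ (matrixUnit x₀ x₀) = rankOne ℂ η η)
    (hsupp : ∀ ξ, (∀ x, φ (matrixUnit x x) ξ = 0) → φ 1 ξ = 0) :
    ∃ u : Ell2 X →ₗᵢ[ℂ] H, ∀ a : uniformRoeAlgebra X, φ a =
      u.toContinuousLinearMap ∘L (a : BddOp (Ell2 X)) ∘L
        ContinuousLinearMap.adjoint u.toContinuousLinearMap := by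
  have ho := orthonormal_matrixUnitVector hη h
  have hm := map_matrixUnit h
  obtain ⟨u, hu⟩ := exists_isometry_apply_delta ho
  refine ⟨u, fun a => ?_⟩
  have h1 := map_one_eq ho hm hsupp u hu
  set U := u.toContinuousLinearMap
  have hcomp : ContinuousLinearMap.adjoint U ∘L φ a ∘L U = (a : BddOp (Ell2 X)) :=
    ext_inner_apply_delta fun x y => by
      rw [← inner_map_apply ho hm, ContinuousLinearMap.comp_apply,
        ContinuousLinearMap.adjoint_inner_right, ContinuousLinearMap.comp_apply]
      exact congrArg₂ _ (hu y) (congrArg _ (hu x))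
  have h1a : φ a = φ 1 * φ a * φ 1 := by rw [map_one_mul, map_mul_one]
  rw [← hcomp, h1a, h1]
  ext1 ξ
  simp only [ContinuousLinearMap.comp_apply, mul_apply_eq_comp, U, adjoint_apply_apply]

/-- The same for the empty space, where the uniform Roe algebra vanishes. -/
theorem exists_isometry_of_isEmpty [IsEmpty X] (φ : uniformRoeAlgebra X →⋆ₙₐ[ℂ] BddOp H) :
    ∃ u : Ell2 X →ₗᵢ[ℂ] H, ∀ a : uniformRoeAlgebra X, φ a =
      u.toContinuousLinearMap ∘L (a : BddOp (Ell2 X)) ∘L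
        ContinuousLinearMap.adjoint u.toContinuousLinearMap := by
  have hs : ∀ f : Ell2 X, f = 0 := fun f => ext_inner_delta fun x => isEmptyElim x
  refine ⟨⟨0, fun f => by rw [hs f, map_zero, norm_zero, norm_zero]⟩, fun a => ?_⟩
  have ha : a = 0 := by
    ext1
    exact ContinuousLinearMap.ext fun f => hs _
  rw [ha, map_zero]
  ext1 ξ
  simp

theorem exists_unit_of_isStarProjection {p : BddOp H} (hp : IsStarProjection p) (h0 : p ≠ 0) :
    ∃ η : H, ‖η‖ = 1 ∧ p η = η := by
  obtain ⟨ζ, hζ⟩ := DFunLike.ne_iff.1 h0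
  rw [zero_apply] at hζ
  refine ⟨(‖p ζ‖⁻¹ : ℂ) • p ζ, ?_, ?_⟩
  · rw [norm_smul, norm_inv, Complex.norm_real, norm_norm, inv_mul_cancel₀ (norm_ne_zero_iff.2 hζ)]
  · rw [map_smul, ← mul_apply_eq_comp, hp.isIdempotentElem]

theorem map_matrixUnit_ne_zero (hφ : Function.Injective φ) (x : X) : φ (matrixUnit x x) ≠ 0 := by
  intro h
  have h0 : matrixUnit x x = 0 := hφ (h.trans (map_zero φ).symm)
  have h1 := congrArg (fun a : uniformRoeAlgebra X => ‖(a : BddOp (Ell2 X))‖) h0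
  simp [coe_matrixUnit, norm_delta] at h1

theorem isStarProjection_map_matrixUnit (x : X) : IsStarProjection (φ (matrixUnit x x)) :=
  (isStarProjection_matrixUnit x).map φ

theorem isStarProjection_map_one : IsStarProjection (φ 1) := (IsStarProjection.one _).map φ

/-- If the range of an injective representation contains the compact operators on its support, then
the representation is implemented by an isometry. -/
theorem exists_isometry_of_compact_subset_range (hφ : Function.Injective φ)
    (h : ∀ k : BddOp H, IsCompactOperator k → φ 1 * k * φ 1 ∈ Set.range φ) :
    ∃ u : Ell2 X →ₗᵢ[ℂ] H, ∀ a : uniformRoeAlgebra X, φ a =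
      u.toContinuousLinearMap ∘L (a : BddOp (Ell2 X)) ∘L
        ContinuousLinearMap.adjoint u.toContinuousLinearMap := by
  rcases isEmpty_or_nonempty X with hX | ⟨⟨x₀⟩⟩
  · exact exists_isometry_of_isEmpty φ
  have hpr : IsStarProjection (φ 1) := isStarProjection_map_one
  have hq : ∀ η : H, φ 1 η = η → ∃ b, φ b = rankOne ℂ η η := fun η hη => by
    obtain ⟨b, hb⟩ := h _ (isCompactOperator_rankOne η η)
    refine ⟨b, hb.trans ?_⟩
    rw [ContinuousLinearMap.mul_def, ContinuousLinearMap.mul_def, InnerProductSpace.comp_rankOne,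
      InnerProductSpace.rankOne_comp, ← ContinuousLinearMap.star_eq_adjoint,
      hpr.isSelfAdjoint.star_eq, hη]
  have key : ∀ x : X, ∃ η : H, ‖η‖ = 1 ∧ φ (matrixUnit x x) = rankOne ℂ η η := fun x => by
    have hP : IsStarProjection (φ (matrixUnit x x)) := isStarProjection_map_matrixUnit x
    obtain ⟨η, hη, hPη⟩ := exists_unit_of_isStarProjection hP (map_matrixUnit_ne_zero hφ x)
    obtain ⟨b, hb⟩ := hq η (by
      rw [← hPη, ← mul_apply_eq_comp, ← map_mul, one_mul])
    refine ⟨η, hη, ?_⟩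
    -- Minimality of e_xx: the projection onto η is φ(b) compressed by φ(e_xx), hence a multiple of
    -- φ(e_xx). Evaluating at η, which both fix, shows that the factor is 1.
    have h1 : rankOne ℂ η η =
        φ (matrixUnit x x) * rankOne ℂ η η * φ (matrixUnit x x) := by
      rw [ContinuousLinearMap.mul_def, ContinuousLinearMap.mul_def,
        InnerProductSpace.comp_rankOne, InnerProductSpace.rankOne_comp,
        ← ContinuousLinearMap.star_eq_adjoint, hP.isSelfAdjoint.star_eq, hPη]
    rw [← hb, ← map_mul, ← map_mul, matrixUnit_mul_mul, map_smul, hb] at h1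
    have h2 := DFunLike.congr_fun h1 η
    rw [InnerProductSpace.rankOne_apply, smul_apply, hPη, inner_self_eq_norm_sq_to_K, hη] at h2
    have h3 : η ≠ 0 := fun h0 => by simp [h0] at hη
    have h4 : ⟪delta x, (b : BddOp (Ell2 X)) (delta x)⟫_ℂ = 1 :=
      (smul_left_injective ℂ h3 (by simpa using h2)).symm
    rw [h1, h4, one_smul]
  obtain ⟨η, hη, h0⟩ := key x₀
  refine exists_isometry_of_map_matrixUnit hη h0 fun ξ hξ => ?_
  obtain ⟨b, hb⟩ := hq (φ 1 ξ) (by rw [← mul_apply_eq_comp, ← map_mul, one_mul])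
  -- All columns of b vanish: φ(b e_xx) = 0 because φ(e_xx) kills φ(1)ξ, and φ is injective.
  have hb0 : b = 0 := by
    ext1
    refine ext_apply_delta fun x => ?_
    have h1 : φ (b * matrixUnit x x) = 0 := by
      rw [map_mul, hb, ContinuousLinearMap.mul_def, InnerProductSpace.rankOne_comp,
        ← ContinuousLinearMap.star_eq_adjoint,
        (isStarProjection_map_matrixUnit (φ := φ) x).isSelfAdjoint.star_eq, ← mul_apply_eq_comp,
        ← map_mul, mul_one, hξ, map_zero]
    have h2 : b * matrixUnit x x = 0 := hφ (h1.trans (map_zero φ).symm)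
    have h3 := DFunLike.congr_fun (congrArg (fun a : uniformRoeAlgebra X => (a : BddOp (Ell2 X))) h2)
      (delta x)
    simpa [coe_matrixUnit, norm_delta, mul_apply_eq_comp] using h3
  rw [hb0, map_zero, eq_comm, InnerProductSpace.rankOne_eq_zero, or_self] at hb
  exact hb

end Representation

/-! ### Rank of operators. -/

theorem opRank_rankOne {H : Type*} [NormedAddCommGroup H] [InnerProductSpace ℂ H] {x y : H}
    (hx : x ≠ 0) (hy : y ≠ 0) : opRank (rankOne ℂ x y) = 1 := by
  rw [opRank, InnerProductSpace.rank_rankOne hx hy, map_one]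

/-- Since u*u = 1, the adjoint u* is onto, so the range of uau* is the image of the range of a under
the injective map u. -/
theorem opRank_conj {X H : Type*} [NormedAddCommGroup H] [InnerProductSpace ℂ H] [CompleteSpace H]
    (u : Ell2 X →ₗᵢ[ℂ] H) (a : BddOp (Ell2 X)) :
    opRank (u.toContinuousLinearMap ∘L a ∘L
      ContinuousLinearMap.adjoint u.toContinuousLinearMap) = opRank a := by
  have hr : LinearMap.range (u.toContinuousLinearMap ∘L a ∘L
      ContinuousLinearMap.adjoint u.toContinuousLinearMap : H →ₗ[ℂ] H) =
      (LinearMap.range (a : Ell2 X →ₗ[ℂ] Ell2 X)).map u.toLinearMap := by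
    ext ξ
    constructor
    · rintro ⟨ζ, rfl⟩
      exact ⟨_, ⟨_, rfl⟩, rfl⟩
    · rintro ⟨_, ⟨ζ, rfl⟩, rfl⟩
      refine ⟨u.toContinuousLinearMap ζ, ?_⟩
      change u.toContinuousLinearMap (a (ContinuousLinearMap.adjoint u.toContinuousLinearMap
        (u.toContinuousLinearMap ζ))) = _
      rw [adjoint_apply_apply]
      rfl
  -- The two ranges may live in different universes; `toENat` does not see the cardinal lifts.
  rw [opRank, opRank, LinearMap.rank, LinearMap.rank, hr,
    ← Cardinal.toENat_lift, ← (Submodule.equivMapOfInjective u.toLinearMap u.injective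
      (LinearMap.range (a : Ell2 X →ₗ[ℂ] Ell2 X))).lift_rank_eq, Cardinal.toENat_lift]

/-- The range is spanned by η, and self-adjointness of p identifies the coefficient of p ζ as ⟪η,
ζ⟫. -/
theorem eq_rankOne_of_opRank_eq_one {H : Type*} [NormedAddCommGroup H] [InnerProductSpace ℂ H]
    [CompleteSpace H] {p : BddOp H} (hp : IsStarProjection p) (h : opRank p = 1) {η : H}
    (hη : ‖η‖ = 1) (hpη : p η = η) : p = rankOne ℂ η η := by
  have hfr : Module.finrank ℂ (LinearMap.range (p : H →ₗ[ℂ] H)) = 1 := by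
    rw [← Module.rank_eq_one_iff_finrank_eq_one]
    exact Cardinal.toENat_eq_one.1 h
  have h0 : η ≠ 0 := fun h0 => by simp [h0] at hη
  have hne : (⟨η, η, hpη⟩ : LinearMap.range (p : H →ₗ[ℂ] H)) ≠ 0 := fun h => h0 (congrArg (·.1) h)
  ext1 ζ
  obtain ⟨c, hc⟩ := (finrank_eq_one_iff_of_nonzero' _ hne).1 hfr ⟨p ζ, ζ, rfl⟩
  have hc' : c • η = p ζ := congrArg (·.1) hc
  have hi : ⟪η, p ζ⟫_ℂ = ⟪η, ζ⟫_ℂ := by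
    rw [← ContinuousLinearMap.adjoint_inner_left, ← ContinuousLinearMap.star_eq_adjoint,
      hp.isSelfAdjoint.star_eq, hpη]
  rw [← hc', inner_smul_right, inner_self_eq_norm_sq_to_K, hη] at hi
  rw [InnerProductSpace.rankOne_apply, ← hi, ← hc']
  simp

/-! ### Spatial implementation, rank preservation and strong continuity. -/

variable {X Y : Type*} [MetricSpace X] [MetricSpace Y]

/-- A homomorphism between uniform Roe algebras as a representation on `ℓ₂(Y)`. -/
noncomputable def toRepresentation (Φ : uniformRoeAlgebra X →⋆ₙₐ[ℂ] uniformRoeAlgebra Y) :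
    uniformRoeAlgebra X →⋆ₙₐ[ℂ] BddOp (Ell2 Y) :=
  (uniformRoeAlgebra Y).subtype.toNonUnitalStarAlgHom.comp Φ

theorem toRepresentation_injective {Φ : uniformRoeAlgebra X →⋆ₙₐ[ℂ] uniformRoeAlgebra Y}
    (hΦ : Function.Injective Φ) : Function.Injective (toRepresentation Φ) :=
  Subtype.val_injective.comp hΦ

theorem ImplementedBy.rankPreserving {Φ : uniformRoeAlgebra X → uniformRoeAlgebra Y}
    {u : Ell2 X →ₗᵢ[ℂ] Ell2 Y} (h : ImplementedBy Φ u) : RankPreserving Φ := fun a => by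
  rw [h a, opRank_conj]

theorem ImplementedBy.stronglyContinuous {Φ : uniformRoeAlgebra X → uniformRoeAlgebra Y}
    {u : Ell2 X →ₗᵢ[ℂ] Ell2 Y} (h : ImplementedBy Φ u) : StronglyContinuous Φ := by
  let := strongOperatorTopology X
  refine continuous_induced_rng.2 (continuous_pi fun ξ => ?_)
  have h1 : Continuous fun a : uniformRoeAlgebra X => (a : BddOp (Ell2 X))
      (ContinuousLinearMap.adjoint u.toContinuousLinearMap ξ) :=
    (continuous_apply (ContinuousLinearMap.adjoint u.toContinuousLinearMap ξ)).comp
      continuous_induced_dom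
  convert u.continuous.comp h1 using 2 with a
  exact DFunLike.congr_fun (h a) ξ

theorem sum_matrixUnit_apply (s : Finset X) (ξ : Ell2 X) :
    ((∑ x ∈ s, matrixUnit x x : uniformRoeAlgebra X) : BddOp (Ell2 X)) ξ =
      ∑ x ∈ s, ξ x • delta x := by
  rw [AddSubmonoidClass.coe_finsetSum, sum_apply]
  refine Finset.sum_congr rfl fun x _ => ?_
  rw [coe_matrixUnit, InnerProductSpace.rankOne_apply, inner_delta_left]

/-- The finite diagonal projections converge strongly to the identity. -/
theorem tendsto_sum_matrixUnit :
    Filter.Tendsto (fun s : Finset X => ∑ x ∈ s, matrixUnit x x) Filter.atTop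
      (@nhds _ (strongOperatorTopology X) 1) := by
  classical
  rw [nhds_induced, Filter.tendsto_comap_iff, tendsto_pi_nhds]
  intro ξ
  have hs := lp.hasSum_single (p := 2) (by simp) ξ
  refine hs.congr fun s => ?_
  refine Eq.trans (Finset.sum_congr rfl fun x _ => ?_) (sum_matrixUnit_apply s ξ).symm
  rw [delta, ← lp.single_smul, smul_eq_mul, mul_one]

/-- This is the support condition: the images of the finite diagonal projections all kill ξ and
converge strongly to Φ(1). -/
theorem StronglyContinuous.map_one_apply_eq_zero
    {Φ : uniformRoeAlgebra X →⋆ₙₐ[ℂ] uniformRoeAlgebra Y} (h : StronglyContinuous Φ) {ξ : Ell2 Y}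
    (hξ : ∀ x, toRepresentation Φ (matrixUnit x x) ξ = 0) : toRepresentation Φ 1 ξ = 0 := by
  have h0 : @Continuous _ _ (strongOperatorTopology Y) _
      fun b : uniformRoeAlgebra Y => (b : BddOp (Ell2 Y)) ξ := by
    let := strongOperatorTopology Y
    exact (continuous_apply ξ).comp continuous_induced_dom
  have h1 := @Continuous.comp _ _ _ (strongOperatorTopology X) (strongOperatorTopology Y) _ _ _ h0 h
  have h2 := (@Continuous.tendsto _ _ (strongOperatorTopology X) _ _ h1 1).comp
    tendsto_sum_matrixUnit
  refine tendsto_nhds_unique h2 (tendsto_const_nhds.congr fun s => ?_)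
  change 0 = toRepresentation Φ (∑ x ∈ s, matrixUnit x x) ξ
  rw [map_sum, sum_apply, Finset.sum_eq_zero fun x _ => hξ x]

theorem exists_implementedBy_of_rankPreserving
    {Φ : uniformRoeAlgebra X →⋆ₙₐ[ℂ] uniformRoeAlgebra Y} (hΦ : Function.Injective Φ)
    (hr : RankPreserving Φ) (hc : StronglyContinuous Φ) :
    ∃ u : Ell2 X →ₗᵢ[ℂ] Ell2 Y, ImplementedBy Φ u := by
  rcases isEmpty_or_nonempty X with hX | ⟨⟨x₀⟩⟩
  · exact exists_isometry_of_isEmpty (toRepresentation Φ)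
  have hP := isStarProjection_map_matrixUnit (φ := toRepresentation Φ) x₀
  obtain ⟨η, hη, hPη⟩ := exists_unit_of_isStarProjection hP
    (map_matrixUnit_ne_zero (toRepresentation_injective hΦ) x₀)
  have h0 : (delta x₀ : Ell2 X) ≠ 0 := fun h => by simpa [h] using norm_delta x₀
  have h1 : opRank (toRepresentation Φ (matrixUnit x₀ x₀)) = 1 :=
    (hr _).trans (opRank_rankOne h0 h0)
  exact exists_isometry_of_map_matrixUnit hη (eq_rankOne_of_opRank_eq_one hP h1 hη hPη)
    fun ξ hξ => hc.map_one_apply_eq_zero hξ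

/-! ### Compact operators in the range of Φ. -/

theorem exists_implementedBy_of_compact_subset_opRange
    {Φ : uniformRoeAlgebra X →⋆ₙₐ[ℂ] uniformRoeAlgebra Y} (hΦ : Function.Injective Φ)
    (h : ∀ k : BddOp (Ell2 Y), IsCompactOperator k →
      (Φ 1 : BddOp (Ell2 Y)) * k * (Φ 1 : BddOp (Ell2 Y)) ∈ opRange Φ) :
    ∃ u : Ell2 X →ₗᵢ[ℂ] Ell2 Y, ImplementedBy Φ u :=
  exists_isometry_of_compact_subset_range (toRepresentation_injective hΦ) h

/-- As Φ(1) = UU*, the operator Φ(1)kΦ(1) = U(U*kU)U* is the image of the compact operator U*kU. -/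
theorem ImplementedBy.compact_subset_opRange {Φ : uniformRoeAlgebra X → uniformRoeAlgebra Y}
    {u : Ell2 X →ₗᵢ[ℂ] Ell2 Y} (h : ImplementedBy Φ u) {k : BddOp (Ell2 Y)}
    (hk : IsCompactOperator k) :
    (Φ 1 : BddOp (Ell2 Y)) * k * (Φ 1 : BddOp (Ell2 Y)) ∈ opRange Φ := by
  set U := u.toContinuousLinearMap with hU
  have hk' : IsCompactOperator (ContinuousLinearMap.adjoint U ∘L k ∘L U) :=
    (hk.comp_clm U).clm_comp (ContinuousLinearMap.adjoint U)
  refine ⟨⟨_, mem_uniformRoeAlgebra_of_isCompactOperator hk'⟩, ?_⟩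
  change (Φ _ : BddOp (Ell2 Y)) = _
  rw [h, h]
  rfl

/-! ### Essential ideals of the generated hereditary subalgebra. -/

theorem isStarProjection_coe_map_one (Φ : uniformRoeAlgebra X →⋆ₙₐ[ℂ] uniformRoeAlgebra Y) :
    IsStarProjection (Φ 1 : BddOp (Ell2 Y)) :=
  isStarProjection_map_one (φ := toRepresentation Φ)

theorem hereditarySubalgebra_opRange_le_corner
    (Φ : uniformRoeAlgebra X →⋆ₙₐ[ℂ] uniformRoeAlgebra Y) :
    hereditarySubalgebra (uniformRoeAlgebra Y) (opRange Φ) ≤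
      corner (uniformRoeAlgebra Y) (Φ 1 : BddOp (Ell2 Y)) (isStarProjection_coe_map_one Φ) := by
  refine hereditarySubalgebra_le
    (isHereditarySubalgebra_corner isClosed_uniformRoeAlgebra _) ?_
  rintro _ ⟨a, rfl⟩
  exact ⟨(Φ a).2, map_one_mul (φ := toRepresentation Φ) a, map_mul_one (φ := toRepresentation Φ) a⟩

/-- Elements of the hereditary subalgebra absorb Φ(1) on both sides, which gives the ideal property.
For essentiality, a = aΦ(1) is tested against the rank one operators of the vectors Φ(1)ξ. -/
theorem isEssentialIdeal_compactOperatorsOn_range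
    (Φ : uniformRoeAlgebra X →⋆ₙₐ[ℂ] uniformRoeAlgebra Y)
    (h : (compactOperatorsOn (LinearMap.range ((Φ 1 : BddOp (Ell2 Y)) : Ell2 Y →ₗ[ℂ] Ell2 Y)) :
      Set (BddOp (Ell2 Y))) ⊆ opRange Φ) :
    IsEssentialIdeal
      (compactOperatorsOn (LinearMap.range ((Φ 1 : BddOp (Ell2 Y)) : Ell2 Y →ₗ[ℂ] Ell2 Y)))
      (hereditarySubalgebra (uniformRoeAlgebra Y) (opRange Φ)) := by
  have hp := isStarProjection_coe_map_one Φ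
  have hle := hereditarySubalgebra_opRange_le_corner Φ
  refine ⟨h.trans (subset_hereditarySubalgebra _ _), ?_, fun b hb j hj => ?_, fun b hb j hj => ?_,
    fun a ha haj => ?_⟩
  · exact isClosed_compactOperatorsOn
      (ContinuousLinearMap.IsIdempotentElem.isClosed_range hp.isIdempotentElem)
  · rw [mem_compactOperatorsOn_range_iff hp] at hj ⊢
    refine ⟨hj.1.clm_comp b, ?_, ?_⟩
    · rw [← mul_assoc, (hle hb).2.1]
    · rw [mul_assoc, hj.2.2]
  · rw [mem_compactOperatorsOn_range_iff hp] at hj ⊢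
    refine ⟨hj.1.comp_clm b, ?_, ?_⟩
    · rw [← mul_assoc, hj.2.1]
    · rw [mul_assoc, (hle hb).2.2]
  · rw [← (hle ha).2.2]
    ext1 ξ
    set η := (Φ 1 : BddOp (Ell2 Y)) ξ with hη
    have hpη : (Φ 1 : BddOp (Ell2 Y)) η = η := DFunLike.congr_fun hp.isIdempotentElem ξ
    have h1 := haj (rankOne ℂ η η) ((mem_compactOperatorsOn_range_iff hp).2
      ⟨isCompactOperator_rankOne η η, by
        rw [ContinuousLinearMap.mul_def, InnerProductSpace.comp_rankOne, hpη], by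
        rw [ContinuousLinearMap.mul_def, InnerProductSpace.rankOne_comp,
          ← ContinuousLinearMap.star_eq_adjoint, hp.isSelfAdjoint.star_eq, hpη]⟩)
    rw [ContinuousLinearMap.mul_def, InnerProductSpace.comp_rankOne,
      InnerProductSpace.rankOne_eq_zero] at h1
    change a η = 0
    rcases h1 with h1 | h1
    · exact h1
    · rw [h1, map_zero]

/-- If the compact operators on `K` form an essential ideal of the hereditary subalgebra generated
by the range of `Φ`, then `K` contains the range of `Φ 1`. -/
theorem map_one_apply_mem_of_isEssentialIdeal
    {Φ : uniformRoeAlgebra X →⋆ₙₐ[ℂ] uniformRoeAlgebra Y} {K : Submodule ℂ (Ell2 Y)}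
    (hK : IsClosed (K : Set (Ell2 Y)))
    (h : IsEssentialIdeal (compactOperatorsOn K)
      (hereditarySubalgebra (uniformRoeAlgebra Y) (opRange Φ)))
    (hK1 : ∀ ξ ∈ K, (Φ 1 : BddOp (Ell2 Y)) ξ = ξ) (ζ : Ell2 Y) :
    (Φ 1 : BddOp (Ell2 Y)) ζ ∈ K := by
  have hp := isStarProjection_coe_map_one Φ
  have : CompleteSpace K := hK.completeSpace_coe
  rw [← Submodule.orthogonal_orthogonal K, Submodule.mem_orthogonal]
  have hpp : ∀ ξ, (Φ 1 : BddOp (Ell2 Y)) ((Φ 1 : BddOp (Ell2 Y)) ξ) = (Φ 1 : BddOp (Ell2 Y)) ξ :=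
    fun ξ => DFunLike.congr_fun hp.isIdempotentElem ξ
  have hsa : ∀ ξ η, ⟪(Φ 1 : BddOp (Ell2 Y)) ξ, η⟫_ℂ = ⟪ξ, (Φ 1 : BddOp (Ell2 Y)) η⟫_ℂ :=
    fun ξ η => by
      conv_lhs => rw [← hp.isSelfAdjoint.star_eq, ContinuousLinearMap.star_eq_adjoint]
      exact ContinuousLinearMap.adjoint_inner_left _ _ _
  intro ξ hξ
  rw [← hsa]
  by_contra hne
  -- The normalization η of ω is orthogonal to K. Its rank one projection lies below Φ(1), so
  -- heredity puts it in the subalgebra, yet it annihilates the compact operators on K, against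
  -- essentiality.
  set ω := (Φ 1 : BddOp (Ell2 Y)) ξ with hω
  have hω0 : ω ≠ 0 := fun h0 => hne (by rw [h0, inner_zero_left])
  set η := (‖ω‖⁻¹ : ℂ) • ω with hη
  have hη1 : ‖η‖ = 1 := by
    rw [hη, norm_smul, norm_inv, Complex.norm_real, norm_norm,
      inv_mul_cancel₀ (norm_ne_zero_iff.2 hω0)]
  have hpη : (Φ 1 : BddOp (Ell2 Y)) η = η := by rw [hη, map_smul, hω, hpp]
  have hKη : ∀ κ ∈ K, ⟪η, κ⟫_ℂ = 0 := fun κ hκ => by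
    rw [hη, inner_smul_left, hω, hsa, hK1 κ hκ, Submodule.inner_left_of_mem_orthogonal hκ hξ,
      mul_zero]
  have hmem : rankOne ℂ η η ∈ hereditarySubalgebra (uniformRoeAlgebra Y) (opRange Φ) :=
    mem_hereditarySubalgebra_of_le
      (mem_uniformRoeAlgebra_of_isCompactOperator (isCompactOperator_rankOne η η)) ⟨1, rfl⟩
      (InnerProductSpace.isStarProjection_rankOne_self hη1).nonneg (rankOne_self_le hp hη1 hpη)
  have h0 := h.essential _ hmem fun j hj => by
    ext1 θ
    rw [mul_apply_eq_comp, InnerProductSpace.rankOne_apply, hKη _ (hj.2.1 θ), zero_smul,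
      zero_apply]
  rw [InnerProductSpace.rankOne_eq_zero, or_self] at h0
  rw [h0, norm_zero] at hη1
  exact zero_ne_one hη1

theorem compact_subset_opRange_of_isEssentialIdeal
    {Φ : uniformRoeAlgebra X →⋆ₙₐ[ℂ] uniformRoeAlgebra Y} {K : Submodule ℂ (Ell2 Y)}
    (hK : IsClosed (K : Set (Ell2 Y)))
    (hKΦ : (compactOperatorsOn K : Set (BddOp (Ell2 Y))) ⊆ opRange Φ)
    (h : IsEssentialIdeal (compactOperatorsOn K)
      (hereditarySubalgebra (uniformRoeAlgebra Y) (opRange Φ)))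
    {k : BddOp (Ell2 Y)} (hk : IsCompactOperator k) :
    (Φ 1 : BddOp (Ell2 Y)) * k * (Φ 1 : BddOp (Ell2 Y)) ∈ opRange Φ := by
  have hp := isStarProjection_coe_map_one Φ
  -- The rank one operator of ξ is some Φ(a), so Φ(1) acts on it as the identity. Together with
  -- `map_one_apply_mem_of_isEssentialIdeal` this forces K to be the range of Φ(1).
  have hK1 : ∀ ξ ∈ K, (Φ 1 : BddOp (Ell2 Y)) ξ = ξ := fun ξ hξ => by
    rcases eq_or_ne ξ 0 with rfl | hξ0
    · exact map_zero _
    have hr : rankOne ℂ ξ ξ ∈ compactOperatorsOn K :=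
      ⟨isCompactOperator_rankOne ξ ξ, fun ζ => K.smul_mem _ hξ, fun ζ hζ => by
        rw [InnerProductSpace.rankOne_apply, Submodule.inner_right_of_mem_orthogonal hξ hζ,
          zero_smul]⟩
    obtain ⟨a, ha⟩ := hKΦ hr
    have h1 : (Φ 1 : BddOp (Ell2 Y)) * rankOne ℂ ξ ξ = rankOne ℂ ξ ξ := by
      rw [← ha]
      exact map_one_mul (φ := toRepresentation Φ) a
    have h2 := DFunLike.congr_fun h1 ξ
    rw [mul_apply_eq_comp, InnerProductSpace.rankOne_apply, map_smul] at h2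
    exact smul_right_injective _ (inner_self_ne_zero.2 hξ0) h2
  have hmem := map_one_apply_mem_of_isEssentialIdeal hK h hK1
  have hKr : K = LinearMap.range ((Φ 1 : BddOp (Ell2 Y)) : Ell2 Y →ₗ[ℂ] Ell2 Y) :=
    le_antisymm (fun ξ hξ => ⟨ξ, hK1 ξ hξ⟩) (by rintro _ ⟨ζ, rfl⟩; exact hmem ζ)
  refine hKΦ ?_
  rw [hKr]
  exact (mem_compactOperatorsOn_range_iff hp).2
    ⟨(hk.clm_comp (Φ 1 : BddOp (Ell2 Y))).comp_clm (Φ 1 : BddOp (Ell2 Y)),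
      by rw [← mul_assoc, ← mul_assoc, hp.isIdempotentElem.eq],
      by rw [mul_assoc, hp.isIdempotentElem.eq]⟩

end UniformRoe

theorem mainTheorem8 {X Y : Type*} [MetricSpace X] [MetricSpace Y]
    (hX : UniformlyLocallyFinite X) (hY : UniformlyLocallyFinite Y)
    (Φ : uniformRoeAlgebra X →⋆ₙₐ[ℂ] uniformRoeAlgebra Y) (hΦ : Function.Injective Φ) :
    List.TFAE
      [∃ u : Ell2 X →ₗᵢ[ℂ] Ell2 Y, UniformRoe.ImplementedBy Φ u,
       UniformRoe.RankPreserving Φ ∧ UniformRoe.StronglyContinuous Φ,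
       ∀ k : BddOp (Ell2 Y), IsCompactOperator k →
        (Φ 1 : BddOp (Ell2 Y)) * k * (Φ 1 : BddOp (Ell2 Y)) ∈ UniformRoe.opRange Φ,
       ∃ K : Submodule ℂ (Ell2 Y), IsClosed (K : Set (Ell2 Y)) ∧
        (UniformRoe.compactOperatorsOn K : Set (BddOp (Ell2 Y))) ⊆ UniformRoe.opRange Φ ∧
        UniformRoe.IsEssentialIdeal (UniformRoe.compactOperatorsOn K)
          (UniformRoe.hereditarySubalgebra (uniformRoeAlgebra Y) (UniformRoe.opRange Φ))] := by
  have hp := UniformRoe.isStarProjection_coe_map_one Φ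
  tfae_have 1 → 2 := fun ⟨_, hu⟩ => ⟨hu.rankPreserving, hu.stronglyContinuous⟩
  tfae_have 2 → 1 := fun h => UniformRoe.exists_implementedBy_of_rankPreserving hΦ h.1 h.2
  tfae_have 1 → 3 := fun ⟨_, hu⟩ _ hk => hu.compact_subset_opRange hk
  tfae_have 3 → 1 := UniformRoe.exists_implementedBy_of_compact_subset_opRange hΦ
  tfae_have 3 → 4 := fun h => by
    have hsub : (UniformRoe.compactOperatorsOn
        (LinearMap.range ((Φ 1 : BddOp (Ell2 Y)) : Ell2 Y →ₗ[ℂ] Ell2 Y)) :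
        Set (BddOp (Ell2 Y))) ⊆ UniformRoe.opRange Φ := fun k hk => by
      obtain ⟨hk, h1, h2⟩ := (UniformRoe.mem_compactOperatorsOn_range_iff hp).1 hk
      have h3 := h k hk
      rwa [h1, h2] at h3
    exact ⟨_, ContinuousLinearMap.IsIdempotentElem.isClosed_range hp.isIdempotentElem, hsub,
      UniformRoe.isEssentialIdeal_compactOperatorsOn_range Φ hsub⟩
  tfae_have 4 → 3 := fun ⟨_, hK, hKΦ, h⟩ _ hk =>
    UniformRoe.compact_subset_opRange_of_isEssentialIdeal hK hKΦ h hk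
  tfae_finish
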